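/- Let $\mathbb K=\mathbb R$ or $\mathbb C$; "lcHs" means locally convex Hausdorff space over $\mathbb K$, and $X'$ is the space of continuous linear functionals on an lcHs $X$. Write $X\varepsilon E:=L_e(X'_\kappa,E)$ for the space of continuous linear maps $X'_\kappa\to E$ with the topology of uniform convergence on equicontinuous subsets of $X'$, where $X'_\kappa$ is $X'$ with the topology of uniform convergence on absolutely convex compact subsets of $X$. Let $E$ be a locally complete lcHs, i.e. for every closed bounded absolutely convex $D\subset E$ the space $E_D=\bigcup_{n\in\mathbb N} nD$, normed by the gauge functional of $D$, is a Banach space. Let $G\subset E'$ be a linear subspace that determines boundedness, i.e. every $\sigma(E,G)$-bounded subset of $E$ is bounded in $E$. Let $\Omega$ be a set, and let $\mathcal F(\Omega)\subset\mathbb K^\Omega$ and $\mathcal F(\Omega,E)\subset E^\Omega$ be linear subspaces, each equipped with an lcHs topology, such that every point evaluation $\delta_x$, $x\in\Omega$, belongs to $\mathcal F(\Omega)'$. Assume that $\mathcal F(\Omega)$ is a Fréchet–Schwartz space and that $\mathcal F(\Omega)$ and $\mathcal F(\Omega,E)$ are $\varepsilon$-into-compatible, i.e. that $$S\colon \mathcal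 F(\Omega)\varepsilon E\to\mathcal F(\Omega,E),\qquad S(u)(x):=u(\delta_x),$$ is well defined and a topological isomorphism onto its range. Let $(\omega_m)_{m\in M}$ be a family of sets, and for each $m\in M$ let $T^{\mathbb K}_m\colon \operatorname{dom}T^{\mathbb K}_m\to\mathbb K^{\omega_m}$ and $T^E_m\colon\operatorname{dom}T^E_m\to E^{\omega_m}$ be linear with $\mathcal F(\Omega)\subset\operatorname{dom}T^{\mathbb K}_m\subset\mathbb K^\Omega$ and $\mathcal F(\Omega,E)\subset\operatorname{dom}T^E_m\subset E^\Omega$. Put $T^{\mathbb K}_{m,x}(g):=T^{\mathbb K}_m(g)(x)$ for $g\in\mathcal F(\Omega)$. Assume that the family $(T^E_m,T^{\mathbb K}_m)_{m\in M}$ is * consistent: for all $u\in\mathcal F(\Omega)\varepsilon E$, $m\in M$, $x\in\omega_m$ we have $S(u)\in\mathcal F(\Omega,E)$, $T^{\mathbb K}_{m,x}\in\mathcal F(\Omega)'$ and $T^E_m(S(u))(x)=u(T^{\mathbb K}_{m,x})$; * strong: for all $e'\in E'$, $f\in\mathcal F(\Omega,E)$, $m\in M$, $x\in\omega_m$ we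 have $e'\circ f\in\mathcal F(\Omega)$ and $T^{\mathbb K}_m(e'\circ f)(x)=e'(T^E_m(f)(x))$. Let $U\subset\bigcup_{m\in M}(\{m\}\times\omega_m)$ be a set of uniqueness for $(T^{\mathbb K}_m,\mathcal F)_{m\in M}$, i.e. $T^{\mathbb K}_{m,x}\in\mathcal F(\Omega)'$ for all $(m,x)\in U$, and the only $g\in\mathcal F(\Omega)$ with $T^{\mathbb K}_m(g)(x)=0$ for all $(m,x)\in U$ is $g=0$. Let $\mathcal F_G(U,E)$ be the space of all $f\colon U\to E$ such that for every $e'\in G$ there is $f_{e'}\in\mathcal F(\Omega)$ with $T^{\mathbb K}_m(f_{e'})(x)=e'(f(m,x))$ for all $(m,x)\in U$. Then the (well-defined, linear) restriction map $$R_{U,G}\colon S(\mathcal F(\Omega)\varepsilon E)\to\mathcal F_G(U,E),\qquad F\mapsto\bigl(T^E_m(F)(x)\bigr)_{(m,x)\in U},$$ is surjective: for every $f\in\mathcal F_G(U,E)$ there is $F\in S(\mathcal F(\Omega)\varepsilon E)$ with $T^E_m(F)(x)=f(m,x)$ for all $(m,x)\in U$. -/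

import Mathlib

open Set Filter Topology
open scoped Pointwise ComplexOrder

/-! ### Locally convex notions

A locally convex Hausdorff space over `𝕜 = ℝ` or `ℂ` is a `𝕜`-vector space with a Hausdorff topology
induced by a family of seminorms (`PolynormableSpace 𝕜 E` and `T2Space E`). -/

section LocallyConvex

variable (𝕜 : Type*) [RCLike 𝕜]

/-- The linear span `E_D = ⋃ₙ n D` of a disk `D`. -/
def diskSpace {E : Type*} [AddCommGroup E] [Module 𝕜 E] (D : Set E) : Set E :=
  ⋃ n : ℕ, (n : 𝕜) • D

/-- The gauge (Minkowski) functional of `D`. -/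
noncomputable def diskGauge {E : Type*} [AddCommGroup E] [Module 𝕜 E] (D : Set E) (x : E) : ℝ :=
  sInf {r : ℝ | 0 < r ∧ x ∈ (r : 𝕜) • D}

/-- `E` is locally complete: for every closed disk `D` (closed, bounded, absolutely convex set) the
space `E_D`, normed by the gauge functional of `D`, is a Banach space. -/
def IsLocallyComplete (E : Type*) [AddCommGroup E] [Module 𝕜 E] [TopologicalSpace E] : Prop :=
  ∀ D : Set E, IsClosed D → Bornology.IsVonNBounded 𝕜 D → AbsConvex 𝕜 D →
    ∀ x : ℕ → E, (∀ n, x n ∈ diskSpace 𝕜 D) →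
      (∀ ε : ℝ, 0 < ε → ∃ N, ∀ m ≥ N, ∀ n ≥ N, diskGauge 𝕜 D (x m - x n) < ε) →
      ∃ a ∈ diskSpace 𝕜 D, Tendsto (fun n => diskGauge 𝕜 D (x n - a)) atTop (𝓝 0)

/-- The weak topology `σ(E, G)` on `E` induced by a subspace `G` of the dual `E'`. -/
abbrev sigmaTopology {E : Type*} [AddCommGroup E] [Module 𝕜 E] [TopologicalSpace E]
    (G : Submodule 𝕜 (StrongDual 𝕜 E)) : TopologicalSpace E :=
  ⨅ g : G, TopologicalSpace.induced (fun x : E => (g : StrongDual 𝕜 E) x) inferInstance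

/-- `G ⊂ E'` determines boundedness: every `σ(E, G)`-bounded subset of `E` is bounded in `E`. -/
def DeterminesBoundedness {E : Type*} [AddCommGroup E] [Module 𝕜 E] [TopologicalSpace E]
    (G : Submodule 𝕜 (StrongDual 𝕜 E)) : Prop :=
  ∀ B : Set E, @Bornology.IsVonNBounded 𝕜 E _ _ _ (sigmaTopology 𝕜 G) B →
    Bornology.IsVonNBounded 𝕜 B

/-- `X` is a Schwartz space: for every zero neighbourhood `V` there is a zero neighbourhood `W`
which, for every `ε > 0`, can be covered by finitely many translates of `ε V`. -/
def IsSchwartzLCS (X : Type*) [AddCommGroup X] [Module 𝕜 X] [TopologicalSpace X] : Prop :=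
  ∀ V ∈ 𝓝 (0 : X), ∃ W ∈ 𝓝 (0 : X), ∀ ε : ℝ, 0 < ε →
    ∃ A : Set X, A.Finite ∧ W ⊆ A + (ε : 𝕜) • V

/-- A locally convex Hausdorff space `X` is a Fréchet–Schwartz space: it is metrizable, complete
(for the uniform structure of its additive group) and a Schwartz space. -/
structure IsFrechetSchwartz (X : Type*) [AddCommGroup X] [Module 𝕜 X] [TopologicalSpace X]
    [IsTopologicalAddGroup X] : Prop where
  metrizable : TopologicalSpace.MetrizableSpace X
  complete : @CompleteSpace X (IsTopologicalAddGroup.rightUniformSpace X)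
  schwartz : IsSchwartzLCS 𝕜 X

/-- The dual `X'_κ` of `X` with the topology of uniform convergence on the absolutely convex compact
subsets of `X`. -/
abbrev DualKappa (X : Type*) [AddCommGroup X] [Module 𝕜 X] [TopologicalSpace X] : Type _ :=
  UniformConvergenceCLM (RingHom.id 𝕜) (E := X) 𝕜 {K : Set X | IsCompact K ∧ AbsConvex 𝕜 K}

/-- A continuous linear functional as an element of `X'_κ`. -/
def toDualKappa {X : Type*} [AddCommGroup X] [Module 𝕜 X] [TopologicalSpace X]
    (y : StrongDual 𝕜 X) : DualKappa 𝕜 X :=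
  UniformConvergenceCLM.ofFun (RingHom.id 𝕜) 𝕜 _ y

/-- Schwartz' `ε`-product `X ε E = L_e(X'_κ, E)`: continuous linear maps from `X'_κ` to `E` with the
topology of uniform convergence on the equicontinuous subsets of `X'`. -/
abbrev EpsProduct (X E : Type*) [AddCommGroup X] [Module 𝕜 X] [TopologicalSpace X]
    [AddCommGroup E] [Module 𝕜 E] [TopologicalSpace E] : Type _ :=
  UniformConvergenceCLM (RingHom.id 𝕜) (E := DualKappa 𝕜 X) E
    {B : Set (DualKappa 𝕜 X) | Equicontinuous (fun (y : B) (x : X) => (y : DualKappa 𝕜 X) x)}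

end LocallyConvex

/-! ### Spaces of functions -/

/-- A locally convex Hausdorff space of `E`-valued functions on `Ω`: a linear subspace of `E^Ω` with
a locally convex Hausdorff topology of its own (unrelated to the product topology). -/
structure FunctionSpace (𝕜 Ω E : Type*) [RCLike 𝕜] [AddCommGroup E] [Module 𝕜 E] where
  carrier : Submodule 𝕜 (Ω → E)
  topology : TopologicalSpace carrier
  polynormable : PolynormableSpace 𝕜 carrier (topology := topology)
  t2 : @T2Space carrier topology

namespace FunctionSpace

variable {𝕜 Ω E : Type*} [RCLike 𝕜] [AddCommGroup E] [Module 𝕜 E]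

/-- The elements of the function space, as a type carrying the topology of the function space. -/
def Elem (F : FunctionSpace 𝕜 Ω E) : Type _ := F.carrier

instance : CoeSort (FunctionSpace 𝕜 Ω E) (Type _) := ⟨Elem⟩

variable (F : FunctionSpace 𝕜 Ω E)

instance : AddCommGroup F := inferInstanceAs (AddCommGroup F.carrier)
instance : Module 𝕜 F := inferInstanceAs (Module 𝕜 F.carrier)
instance : TopologicalSpace F := F.topology
instance : PolynormableSpace 𝕜 F := F.polynormable
instance : T2Space F := F.t2
instance : IsTopologicalAddGroup F := (PolynormableSpace.withSeminorms 𝕜 F).topologicalAddGroup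
instance : ContinuousSMul 𝕜 F := (PolynormableSpace.withSeminorms 𝕜 F).continuousSMul

/-- The inclusion of the function space into `E^Ω`. -/
def incl : F →ₗ[𝕜] (Ω → E) := F.carrier.subtype

/-- A function belonging to the function space, as an element of it. -/
def ofMem (f : Ω → E) (hf : f ∈ F.carrier) : F := (⟨f, hf⟩ : F.carrier)

/-- All point evaluations are continuous, i.e. `δ_x ∈ F(Ω)'` for all `x ∈ Ω`. -/
def HasContinuousEvals [TopologicalSpace E] : Prop :=
  ∀ x : Ω, Continuous fun f : F => F.incl f x

end FunctionSpace

section EpsCompatible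

variable {𝕜 Ω E : Type*} [RCLike 𝕜] [AddCommGroup E] [Module 𝕜 E] [TopologicalSpace E]

/-- The point evaluation `δ_x` as an element of `F(Ω)'_κ`. -/
def delta {F : FunctionSpace 𝕜 Ω 𝕜} (hδ : F.HasContinuousEvals) (x : Ω) : DualKappa 𝕜 F :=
  toDualKappa 𝕜 ⟨(LinearMap.proj x).comp F.incl, hδ x⟩

variable [IsTopologicalAddGroup E] [ContinuousSMul 𝕜 E]

/-- The linear map `S : F(Ω) ε E → E^Ω`, `u ↦ (x ↦ u(δ_x))`. -/
def epsMap {F : FunctionSpace 𝕜 Ω 𝕜} (hδ : F.HasContinuousEvals) :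
    EpsProduct 𝕜 F E →ₗ[𝕜] (Ω → E) where
  toFun u x := u (delta hδ x)
  map_add' _ _ := rfl
  map_smul' _ _ := rfl

/-- `F(Ω)` and `F(Ω, E)` are `ε`-into-compatible: `S` is a well-defined topological isomorphism from
`F(Ω) ε E` onto its range in `F(Ω, E)`. -/
structure EpsIntoCompatible (F : FunctionSpace 𝕜 Ω 𝕜) (FE : FunctionSpace 𝕜 Ω E)
    (hδ : F.HasContinuousEvals) : Prop where
  maps_to : ∀ u : EpsProduct 𝕜 F E, epsMap hδ u ∈ FE.carrier
  isEmbedding : IsEmbedding fun u : EpsProduct 𝕜 F E => FE.ofMem (epsMap hδ u) (maps_to u)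

theorem EpsIntoCompatible.range_le {F : FunctionSpace 𝕜 Ω 𝕜} {FE : FunctionSpace 𝕜 Ω E}
    {hδ : F.HasContinuousEvals} (hc : EpsIntoCompatible F FE hδ) :
    LinearMap.range (epsMap (E := E) hδ) ≤ FE.carrier := by
  rintro _ ⟨u, rfl⟩
  exact hc.maps_to u

end EpsCompatible

/-! ### Families of operators, sets of uniqueness and the restriction map -/

/-- A family of linear maps `T_m : dom T_m → E^{ω_m}`, `m ∈ M`, with
`F(Ω, E) ⊂ dom T_m ⊂ E^Ω`. -/
structure OperatorFamily {𝕜 Ω E M : Type*} [RCLike 𝕜] [AddCommGroup E] [Module 𝕜 E]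
    (F : FunctionSpace 𝕜 Ω E) (ω : M → Type*) where
  T : ∀ m, (Ω → E) →ₗ.[𝕜] (ω m → E)
  carrier_le_domain : ∀ m, F.carrier ≤ (T m).domain

/-- The restriction of `T_m` to the function space. -/
def OperatorFamily.op {𝕜 Ω E M : Type*} [RCLike 𝕜] [AddCommGroup E] [Module 𝕜 E]
    {F : FunctionSpace 𝕜 Ω E} {ω : M → Type*} (A : OperatorFamily F ω) (m : M) :
    F →ₗ[𝕜] (ω m → E) :=
  (A.T m).toFun.comp (Submodule.inclusion (A.carrier_le_domain m))

section Families

variable {𝕜 Ω E M : Type*} [RCLike 𝕜] {ω : M → Type*}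
variable [AddCommGroup E] [Module 𝕜 E] [TopologicalSpace E]
variable {F : FunctionSpace 𝕜 Ω 𝕜} {FE : FunctionSpace 𝕜 Ω E}

/-- The functional `T^𝕜_{m,x} = δ_x ∘ T^𝕜_m` belongs to `F(Ω)'`. -/
def OperatorFamily.IsContinuousAt (TK : OperatorFamily F ω) (m : M) (x : ω m) : Prop :=
  Continuous fun f : F => TK.op m f x

/-- The functional `T^𝕜_{m,x}` as an element of `F(Ω)'_κ`. -/
def OperatorFamily.functional (TK : OperatorFamily F ω) (m : M) (x : ω m)
    (h : TK.IsContinuousAt m x) : DualKappa 𝕜 F :=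
  toDualKappa 𝕜 ⟨(LinearMap.proj x).comp (TK.op m), h⟩

/-- `(T^E_m, T^𝕜_m)_m` is a consistent family for `(F, E)`. -/
structure IsConsistent [IsTopologicalAddGroup E] [ContinuousSMul 𝕜 E]
    (hδ : F.HasContinuousEvals) (TE : OperatorFamily FE ω) (TK : OperatorFamily F ω) : Prop where
  maps_to : ∀ u : EpsProduct 𝕜 F E, epsMap hδ u ∈ FE.carrier
  continuousAt : ∀ m (x : ω m), TK.IsContinuousAt m x
  apply_epsMap : ∀ (u : EpsProduct 𝕜 F E) (m : M) (x : ω m),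
    TE.op m (FE.ofMem (epsMap hδ u) (maps_to u)) x = u (TK.functional m x (continuousAt m x))

/-- `(T^E_m, T^𝕜_m)_m` is a strong family for `(F, E)`. -/
structure IsStrong (TE : OperatorFamily FE ω) (TK : OperatorFamily F ω) : Prop where
  comp_mem : ∀ (e' : StrongDual 𝕜 E) (f : FE), (fun x => e' (FE.incl f x)) ∈ F.carrier
  apply_comp : ∀ (e' : StrongDual 𝕜 E) (f : FE) (m : M) (x : ω m),
    TK.op m (F.ofMem (fun x => e' (FE.incl f x)) (comp_mem e' f)) x = e' (TE.op m f x)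

/-- `U ⊂ ⋃_m {m} × ω_m` is a set of uniqueness for `(T^𝕜_m, F)_m`. -/
structure IsSetOfUniqueness (TK : OperatorFamily F ω) (U : Set (Σ m, ω m)) : Prop where
  continuousAt : ∀ p ∈ U, TK.IsContinuousAt p.1 p.2
  eq_zero : ∀ f : F, (∀ p ∈ U, TK.op p.1 f p.2 = 0) → f = 0

/-- The space `F_G(U, E)` of all `f : U → E` such that for every `e' ∈ G` there is `f_{e'} ∈ F(Ω)`
with `T^𝕜_m(f_{e'})(x) = (e' ∘ f)(m, x)` for all `(m, x) ∈ U`. -/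
def restrictionSpace (TK : OperatorFamily F ω) (G : Submodule 𝕜 (StrongDual 𝕜 E))
    (U : Set (Σ m, ω m)) : Submodule 𝕜 (U → E) where
  carrier := {f | ∀ e' ∈ G, ∃ g : F, ∀ p : U, TK.op p.1.1 g p.1.2 = e' (f p)}
  add_mem' := by
    intro f₁ f₂ h₁ h₂ e' he'
    obtain ⟨g₁, hg₁⟩ := h₁ e' he'
    obtain ⟨g₂, hg₂⟩ := h₂ e' he'
    exact ⟨g₁ + g₂, fun p => by simp [hg₁ p, hg₂ p]⟩
  zero_mem' := fun e' _ => ⟨0, fun p => by simp⟩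
  smul_mem' := by
    intro c f h e' he'
    obtain ⟨g, hg⟩ := h e' he'
    exact ⟨c • g, fun p => by simp [hg p]⟩

variable [IsTopologicalAddGroup E] [ContinuousSMul 𝕜 E]

/-- The restriction map `R_{U,G} : S(F(Ω) ε E) → F_G(U, E)`,
`f ↦ (T^E_m(f)(x))_{(m,x) ∈ U}`. -/
def restrictionMap {hδ : F.HasContinuousEvals} (hc : EpsIntoCompatible F FE hδ)
    {TE : OperatorFamily FE ω} {TK : OperatorFamily F ω} (hs : IsStrong TE TK)
    (G : Submodule 𝕜 (StrongDual 𝕜 E)) (U : Set (Σ m, ω m)) :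
    LinearMap.range (epsMap (E := E) hδ) →ₗ[𝕜] restrictionSpace TK G U where
  toFun := fun f => ⟨fun p => TE.op p.1.1 (FE.ofMem f (hc.range_le f.2)) p.1.2,
    fun e' _ => ⟨_, fun p => hs.apply_comp e' (FE.ofMem f (hc.range_le f.2)) p.1.1 p.1.2⟩⟩
  map_add' := fun f g => by
    ext p
    exact congrFun ((TE.op p.1.1).map_add (FE.ofMem f (hc.range_le f.2))
      (FE.ofMem g (hc.range_le g.2))) p.1.2
  map_smul' := fun c f => by
    ext p
    exact congrFun ((TE.op p.1.1).map_smul c (FE.ofMem f (hc.range_le f.2))) p.1.2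

end Families

/-! Put `X = F(Ω)` and, for `g ∈ G`, let `φ g ∈ X` be the function extending `g ∘ f`. Call `y ∈ X'`
represented by `e ∈ E` if `g e = y (φ g)` for all `g ∈ G`. Then `f p` represents the functional
`T^𝕜_p`, so a continuous `u : X'_κ → E` sending every functional to its representative gives the
desired `F = S u`, by consistency.

The represented functionals form a subspace `H` which separates points because `U` is a set of
uniqueness. On the polar of a zero neighbourhood, weak-* approximation is uniform on a smaller
neighbourhood `W` (Schwartz property). The representatives of `W°` form a bounded disk because `G`
determines boundedness, so uniform estimates on `W` become gauge estimates in `E`. Hence `H ∩ V°` is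
weak-* closed by local completeness (`isClosed_representable_inter_polar`), and Krein–Šmulian
(`eq_top_of_forall_isClosed_inter_polar`) gives `H = X'`. The same estimate makes the representation
map weak-* continuous on polars (`isClosed_setOf_notMem_inter_polar`), and Banach–Dieudonné turns
this into continuity on `X'_κ`. -/

/-! ### Polars and compact disks. -/

theorem exists_smul_mem_of_mem_nhds_zero (𝕜 : Type*) {X : Type*} [RCLike 𝕜] [AddCommGroup X]
    [Module 𝕜 X] [TopologicalSpace X] [ContinuousSMul 𝕜 X] {V : Set X} (hV : V ∈ 𝓝 (0 : X))
    (x : X) : ∃ c : 𝕜, c ≠ 0 ∧ c • x ∈ V := by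
  have h : Tendsto (fun c : 𝕜 => c • x) (𝓝[≠] 0) (𝓝 0) := by
    have h := (by fun_prop : Continuous fun c : 𝕜 => c • x).tendsto 0
    rw [zero_smul] at h
    exact h.mono_left nhdsWithin_le_nhds
  obtain ⟨c, hc⟩ := ((h.eventually hV).and self_mem_nhdsWithin).exists
  exact ⟨c, hc.2, hc.1⟩

/-- A linear functional bounded on a zero neighbourhood is automatically continuous, so only
pointwise closed conditions remain. -/
theorem WeakDual.image_coe_polar_of_mem_nhds_zero {𝕜 X : Type*} [RCLike 𝕜] [AddCommGroup X]
    [Module 𝕜 X] [TopologicalSpace X] [IsTopologicalAddGroup X] [ContinuousSMul 𝕜 X] {V : Set X}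
    (hV : V ∈ 𝓝 (0 : X)) : (fun (y : WeakDual 𝕜 X) (x : X) => y x) '' WeakDual.polar 𝕜 V =
      {f : X → 𝕜 | (∀ x y, f (x + y) = f x + f y) ∧ (∀ (c : 𝕜) x, f (c • x) = c * f x) ∧
        ∀ v ∈ V, ‖f v‖ ≤ 1} := by
  ext f
  constructor
  · rintro ⟨y, hy, rfl⟩
    exact ⟨fun _ _ => map_add y _ _, fun _ _ => map_smul y _ _, hy⟩
  · rintro ⟨h₁, h₂, h₃⟩
    let l : X →ₗ[𝕜] 𝕜 := { toFun := f, map_add' := h₁, map_smul' := h₂ }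
    have hl : ∃ V ∈ 𝓝 (0 : X), Bornology.IsVonNBounded 𝕜 (l '' V) := by
      refine ⟨V, hV, (NormedSpace.isVonNBounded_closedBall 𝕜 𝕜 1).subset ?_⟩
      rintro _ ⟨v, hv, rfl⟩
      exact mem_closedBall_zero_iff.2 (h₃ v hv)
    exact ⟨StrongDual.toWeakDual (l.clmOfExistsBoundedImage hl), fun v hv => h₃ v hv, rfl⟩

theorem isClosed_setOf_linear_norm_le_one {𝕜 X : Type*} [RCLike 𝕜] [AddCommGroup X]
    [Module 𝕜 X] (V : Set X) :
    IsClosed {f : X → 𝕜 | (∀ x y, f (x + y) = f x + f y) ∧ (∀ (c : 𝕜) x, f (c • x) = c * f x) ∧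
      ∀ v ∈ V, ‖f v‖ ≤ 1} := by
  have h₁ : IsClosed {f : X → 𝕜 | ∀ x y, f (x + y) = f x + f y} := by
    rw [show {f : X → 𝕜 | ∀ x y, f (x + y) = f x + f y} =
      ⋂ x, ⋂ y, {f : X → 𝕜 | f (x + y) = f x + f y} by ext; simp]
    exact isClosed_iInter fun x => isClosed_iInter fun y =>
      isClosed_eq (continuous_apply _) ((continuous_apply x).add (continuous_apply y))
  have h₂ : IsClosed {f : X → 𝕜 | ∀ (c : 𝕜) x, f (c • x) = c * f x} := by
    rw [show {f : X → 𝕜 | ∀ (c : 𝕜) x, f (c • x) = c * f x} =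
      ⋂ c : 𝕜, ⋂ x, {f : X → 𝕜 | f (c • x) = c * f x} by ext; simp]
    exact isClosed_iInter fun c => isClosed_iInter fun x =>
      isClosed_eq (continuous_apply _) (continuous_const.mul (continuous_apply _))
  have h₃ : IsClosed {f : X → 𝕜 | ∀ v ∈ V, ‖f v‖ ≤ 1} := by
    rw [show {f : X → 𝕜 | ∀ v ∈ V, ‖f v‖ ≤ 1} = ⋂ v ∈ V, {f : X → 𝕜 | ‖f v‖ ≤ 1} by ext; simp]
    exact isClosed_iInter fun v => isClosed_iInter fun _ =>
      isClosed_le (continuous_apply _).norm continuous_const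
  exact h₁.inter (h₂.inter h₃)

/-- Banach–Alaoglu: since `V` is absorbing, the polar embeds as a closed subset of a product of
closed discs. -/
theorem WeakDual.isCompact_polar_of_mem_nhds_zero {𝕜 X : Type*} [RCLike 𝕜] [AddCommGroup X]
    [Module 𝕜 X] [TopologicalSpace X] [IsTopologicalAddGroup X] [ContinuousSMul 𝕜 X] {V : Set X}
    (hV : V ∈ 𝓝 (0 : X)) : IsCompact (WeakDual.polar 𝕜 V) := by
  have hemb : IsEmbedding fun (y : WeakDual 𝕜 X) (x : X) => y x :=
    WeakBilin.isEmbedding ContinuousLinearMap.coe_injective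
  have hbound : ∀ x : X, ∃ r : ℝ, ∀ y ∈ WeakDual.polar 𝕜 V, ‖y x‖ ≤ r := by
    intro x
    obtain ⟨c, hc, hxc⟩ := exists_smul_mem_of_mem_nhds_zero 𝕜 hV x
    refine ⟨‖c‖⁻¹, fun f hf => ?_⟩
    have : ‖f (c • x)‖ ≤ 1 := hf _ hxc
    rw [map_smul, norm_smul] at this
    rwa [← one_div, le_div_iff₀' (norm_pos_iff.2 hc)]
  choose r hr using hbound
  have hK : IsCompact (Set.pi univ fun x : X => Metric.closedBall (0 : 𝕜) (r x)) :=
    isCompact_univ_pi fun x => ProperSpace.isCompact_closedBall (0 : 𝕜) (r x)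
  have hC : IsClosed ((fun (y : WeakDual 𝕜 X) (x : X) => y x) '' WeakDual.polar 𝕜 V) := by
    rw [WeakDual.image_coe_polar_of_mem_nhds_zero hV]
    exact isClosed_setOf_linear_norm_le_one V
  refine hemb.isCompact_iff.2 (hK.of_isClosed_subset hC ?_)
  rintro _ ⟨y, hy, rfl⟩ x -
  exact mem_closedBall_zero_iff.2 (hr x y hy)

/-- The closure of the precompact set `T` is compact by completeness. Multiplying it by the closed
unit disc keeps it compact and makes it balanced; local convexity keeps the convex hull precompact.
-/
theorem exists_isCompact_absConvex_superset {𝕜 X : Type*} [RCLike 𝕜] [AddCommGroup X] [Module 𝕜 X]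
    [TopologicalSpace X] [IsTopologicalAddGroup X] [ContinuousSMul 𝕜 X] [PolynormableSpace 𝕜 X]
    (hX : @CompleteSpace X (IsTopologicalAddGroup.rightUniformSpace X)) {T : Set X}
    (hT : ∀ V ∈ 𝓝 (0 : X), ∃ A : Set X, A.Finite ∧ T ⊆ A + V) :
    ∃ K : Set X, IsCompact K ∧ AbsConvex 𝕜 K ∧ T ⊆ K := by
  let := IsTopologicalAddGroup.rightUniformSpace X
  have : IsUniformAddGroup X := isUniformAddGroup_of_addCommGroup
  let : Module ℝ X := Module.compHom X (algebraMap ℝ 𝕜)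
  have : IsScalarTower ℝ 𝕜 X := ⟨fun r c x => by
    rw [RCLike.real_smul_eq_coe_mul, mul_smul]; rfl⟩
  have : ContinuousSMul ℝ X := IsScalarTower.continuousSMul (M := ℝ) (α := X) 𝕜
  have : LocallyConvexSpace ℝ X := (PolynormableSpace.withSeminorms 𝕜 X).toLocallyConvexSpace
  have hTb : TotallyBounded T := by
    rw [totallyBounded_iff_subset_finite_iUnion_nhds_zero]
    intro V hV
    obtain ⟨A, hA, hTA⟩ := hT V hV
    refine ⟨A, hA, hTA.trans ?_⟩
    rintro _ ⟨a, ha, v, hv, rfl⟩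
    exact mem_biUnion ha ⟨v, hv, rfl⟩
  have hTc : IsCompact (closure T) := hTb.closure.isCompact_of_isClosed isClosed_closure
  set B : Set X := Metric.closedBall (0 : 𝕜) 1 • closure T with hB
  have hBc : IsCompact B := (isCompact_closedBall (0 : 𝕜) 1).smul_set hTc
  have hBb : Balanced 𝕜 B := by
    rintro c hc _ ⟨_, ⟨d, hd, x, hx, rfl⟩, rfl⟩
    refine ⟨c * d, ?_, x, hx, mul_smul c d x⟩
    rw [mem_closedBall_zero_iff] at hd ⊢
    rw [norm_mul]
    exact mul_le_one₀ hc (norm_nonneg _) hd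
  have hconv : Convex 𝕜 (convexHull ℝ B) := convex_RCLike_iff_convex_real.2 (convex_convexHull ℝ B)
  have habs : AbsConvex 𝕜 (convexHull ℝ B) := by
    refine ⟨fun c hc => ?_, hconv⟩
    let l : X →ₗ[ℝ] X := (LinearMap.lsmul 𝕜 X c).restrictScalars ℝ
    calc c • convexHull ℝ B = l '' convexHull ℝ B := rfl
      _ = convexHull ℝ (l '' B) := l.image_convexHull B
      _ ⊆ convexHull ℝ B := convexHull_mono (hBb c hc)
  refine ⟨closure (convexHull ℝ B), ?_, habs.closure, ?_⟩
  · exact (totallyBounded_convexHull.2 hBc.totallyBounded).closure.isCompact_of_isClosed isClosed_closure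
  · intro x hx
    exact subset_closure (subset_convexHull ℝ B
      ⟨1, by simp, x, subset_closure hx, one_smul 𝕜 x⟩)

/-! ### Separation on a compact disk. -/

theorem StrongDual.apply_pi_prod {𝕜 ι : Type*} [RCLike 𝕜] [Fintype ι] [DecidableEq ι]
    (g : StrongDual 𝕜 ((ι → 𝕜) × 𝕜)) (v : ι → 𝕜) (s : 𝕜) :
    g (v, s) = ∑ i, g (Pi.single i 1, 0) * v i + g (0, 1) * s := by
  have hv : (v, s) = ∑ i, v i • ((Pi.single i 1, 0) : (ι → 𝕜) × 𝕜) + s • ((0, 1) : (ι → 𝕜) × 𝕜) := by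
    ext i
    · simp [Prod.fst_sum, Finset.sum_apply, Pi.single_apply]
    · simp [Prod.snd_sum]
  rw [hv, g.map_add, map_sum, g.map_smul, smul_eq_mul, mul_comm s]
  congr 1
  refine Finset.sum_congr rfl fun i _ => ?_
  rw [g.map_smul, smul_eq_mul, mul_comm (v i)]

/-- Otherwise `(0, 1)` can be separated from the compact convex image of `K` under `(f, y)`.
Dividing the separating functional by its last coefficient yields some `y + ∑ aᵢ fᵢ` of modulus
below `1` on all of `K`. -/
theorem exists_mem_forall_eq_zero_of_one_lt_norm_of_fintype {𝕜 X ι : Type*} [RCLike 𝕜]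
    [AddCommGroup X] [Module 𝕜 X] [TopologicalSpace X] [Fintype ι]
    (f : ι → StrongDual 𝕜 X) (y : StrongDual 𝕜 X) {K : Set X} (hK : IsCompact K)
    (hKc : AbsConvex 𝕜 K) (hy : ∀ a : ι → 𝕜, ∃ x ∈ K, 1 < ‖y x + ∑ i, a i * f i x‖) :
    ∃ x ∈ K, y x = 1 ∧ ∀ i, f i x = 0 := by
  classical
  by_contra! hne
  let Φ : X →L[𝕜] (ι → 𝕜) × 𝕜 := (ContinuousLinearMap.pi f).prod y
  have hconv : Convex ℝ (Φ '' K) :=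
    convex_RCLike_iff_convex_real.1 (hKc.2.linear_image Φ.toLinearMap)
  have hnot : ((0 : ι → 𝕜), (1 : 𝕜)) ∉ Φ '' K := by
    rintro ⟨x, hx, hΦx⟩
    obtain ⟨i, hi⟩ := hne x hx (congrArg Prod.snd hΦx)
    exact hi (congrFun (congrArg Prod.fst hΦx) i)
  obtain ⟨g, c, hgK, hg1⟩ := RCLike.geometric_hahn_banach_closed_point (𝕜 := 𝕜) hconv
    (hK.image Φ.continuous).isClosed hnot
  have hbound : ∀ x ∈ K, ‖g (Φ x)‖ < c := by
    intro x hx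
    -- Balancedness of `K` allows rotating `g (Φ x)` onto the positive axis, so the bound on real
    -- parts bounds the modulus.
    obtain ⟨u, hu, hu'⟩ := RCLike.exists_norm_eq_mul_self (g (Φ x))
    have h := hgK _ ⟨u • x, hKc.1.smul_mem hu.le hx, rfl⟩
    rwa [Φ.map_smul, g.map_smul, smul_eq_mul, ← hu', RCLike.ofReal_re] at h
  have hcd : c < ‖g (0, 1)‖ := hg1.trans_le (RCLike.re_le_norm _)
  -- `hy 0` serves only to show that `K` is nonempty.
  have hd0 : 0 < ‖g (0, 1)‖ :=
    let ⟨x, hx, _⟩ := hy 0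
    ((norm_nonneg _).trans_lt (hbound x hx)).trans hcd
  obtain ⟨x, hx, hlt⟩ := hy fun i => (g (0, 1))⁻¹ * g (Pi.single i 1, 0)
  have heq : g (Φ x) = g (0, 1) * (y x + ∑ i, (g (0, 1))⁻¹ * g (Pi.single i 1, 0) * f i x) := by
    have h : ∀ i, (g (0, 1))⁻¹ * g (Pi.single i 1, 0) * f i x =
      (g (0, 1))⁻¹ * (g (Pi.single i 1, 0) * f i x) := fun i => mul_assoc _ _ _
    rw [show Φ x = ((fun i => f i x), y x) from rfl, g.apply_pi_prod, mul_add, add_comm]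
    simp only [h]
    rw [← Finset.mul_sum, mul_inv_cancel_left₀ (norm_pos_iff.1 hd0)]
  have := (hbound x hx).trans hcd
  rw [heq, norm_mul] at this
  exact this.not_ge (le_mul_of_one_le_right hd0.le hlt.le)

/-- A form of the bipolar theorem: a functional whose distance to a subspace `H`, measured
uniformly on an absolutely convex compact set `K`, exceeds `1`, takes the value `1` at some point of
`K` where `H` vanishes. -/
theorem exists_mem_forall_eq_zero_of_one_lt_norm {𝕜 X : Type*} [RCLike 𝕜]
    [AddCommGroup X] [Module 𝕜 X] [TopologicalSpace X] (H : Submodule 𝕜 (WeakDual 𝕜 X))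
    (y : WeakDual 𝕜 X) {K : Set X} (hK : IsCompact K) (hKc : AbsConvex 𝕜 K)
    (hy : ∀ h ∈ H, ∃ x ∈ K, 1 < ‖(y + h) x‖) :
    ∃ x ∈ K, y x = 1 ∧ ∀ h ∈ H, h x = 0 := by
  classical
  have hcl : ∀ (z : WeakDual 𝕜 X) (c : 𝕜), IsClosed {x : X | z x = c} := fun z c =>
    isClosed_eq (map_continuous z) continuous_const
  -- Compactness of `K ∩ {y = 1}` reduces `H` to finitely many functionals.
  have hfin : ∀ t : Finset H,
      ((K ∩ {x | y x = 1}) ∩ ⋂ h ∈ t, {x : X | (h : WeakDual 𝕜 X) x = 0}).Nonempty := by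
    intro t
    obtain ⟨x, hx, hyx, hxt⟩ := exists_mem_forall_eq_zero_of_one_lt_norm_of_fintype
      (fun h : t => WeakDual.toStrongDual (h : H).1) (WeakDual.toStrongDual y) hK hKc (by
        intro a
        obtain ⟨x, hx, hlt⟩ := hy (∑ h : t, a h • (h : H).1)
          (H.sum_mem fun h _ => H.smul_mem _ h.1.2)
        refine ⟨x, hx, hlt.trans_eq ?_⟩
        congr 1
        change y x + (∑ h : t, a h • (h : H).1) x = _
        congr 1
        exact map_sum ((topDualPairing 𝕜 X).flip x)
          (fun h : t => WeakDual.toStrongDual (a h • (h : H).1)) Finset.univ)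
    refine ⟨x, ⟨hx, hyx⟩, ?_⟩
    simp only [mem_iInter]
    exact fun h hh => hxt ⟨h, hh⟩
  obtain ⟨x, hx, hxH⟩ := (hK.inter_right (hcl y 1)).inter_iInter_nonempty
    (fun h : H => {x : X | (h : WeakDual 𝕜 X) x = 0}) (fun h => hcl h 0) hfin
  exact ⟨x, hx.1, hx.2, fun h hh => mem_iInter.1 hxH ⟨h, hh⟩⟩

/-! ### Banach–Dieudonné and Krein–Šmulian. -/

section BanachDieudonne

variable {𝕜 X : Type*} [RCLike 𝕜] [AddCommGroup X] [Module 𝕜 X] [TopologicalSpace X]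
  [IsTopologicalAddGroup X] [ContinuousSMul 𝕜 X]

-- The inductive step of Banach–Dieudonné. The part of `C ∩ W°` bounded by `1` on `A` is weak-*
-- compact and misses `V°`, so finitely many points of `V` already witness this.
open Classical in
theorem exists_finset_forall_exists_one_lt_norm {C : Set (WeakDual 𝕜 X)} {V W : Set X}
    (hW : W ∈ 𝓝 (0 : X)) (hC : IsClosed (C ∩ WeakDual.polar 𝕜 W)) (A : Finset X)
    (hA : ∀ y ∈ C, y ∈ WeakDual.polar 𝕜 V → ∃ x ∈ A, 1 < ‖y x‖) :
    ∃ B : Finset X, (B : Set X) ⊆ V ∧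
      ∀ y ∈ C, y ∈ WeakDual.polar 𝕜 W → ∃ x ∈ A ∪ B, 1 < ‖y x‖ := by
  have hcl : ∀ S : Set X, IsClosed {y : WeakDual 𝕜 X | ∀ x ∈ S, ‖y x‖ ≤ 1} :=
    WeakDual.isClosed_polar 𝕜
  have hK : IsCompact (C ∩ WeakDual.polar 𝕜 W ∩ {y | ∀ x ∈ (A : Set X), ‖y x‖ ≤ 1}) :=
    ((WeakDual.isCompact_polar_of_mem_nhds_zero hW).of_isClosed_subset hC
      inter_subset_right).inter_right (hcl A)
  obtain ⟨t, ht⟩ := hK.elim_finite_subfamily_closed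
    (fun v : V => {y : WeakDual 𝕜 X | ∀ x ∈ ({(v : X)} : Set X), ‖y x‖ ≤ 1}) (fun v => hcl _) (by
      rw [eq_empty_iff_forall_notMem]
      rintro y ⟨⟨⟨hyC, -⟩, hyA⟩, hyV⟩
      obtain ⟨x, hx, h⟩ := hA y hyC fun v hv => mem_iInter.1 hyV ⟨v, hv⟩ v rfl
      exact h.not_ge (hyA x hx))
  refine ⟨t.image Subtype.val, by simp, fun y hyC hyW => ?_⟩
  by_contra! h
  rw [eq_empty_iff_forall_notMem] at ht
  refine ht y ⟨⟨⟨hyC, hyW⟩, fun x hx => h x (Finset.mem_union_left _ hx)⟩, ?_⟩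
  simp only [mem_iInter]
  rintro v hv x rfl
  exact h v (Finset.mem_union_right _ (Finset.mem_image_of_mem _ hv))

/-- The **Banach–Dieudonné theorem**: in the dual of a Fréchet space, a set whose traces on the
polars of zero neighbourhoods are weak-* closed and which does not contain `0` is disjoint from a
zero neighbourhood for the topology of uniform convergence on absolutely convex compact sets. -/
theorem exists_isCompact_absConvex_forall_exists_one_lt_norm [PolynormableSpace 𝕜 X]
    [FirstCountableTopology X]
    (hX : @CompleteSpace X (IsTopologicalAddGroup.rightUniformSpace X)) {C : Set (WeakDual 𝕜 X)}
    (hC : ∀ V ∈ 𝓝 (0 : X), IsClosed (C ∩ WeakDual.polar 𝕜 V)) (h0 : 0 ∉ C) :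
    ∃ K : Set X, IsCompact K ∧ AbsConvex 𝕜 K ∧ ∀ y ∈ C, ∃ x ∈ K, 1 < ‖y x‖ := by
  classical
  obtain ⟨u, hu⟩ := (𝓝 (0 : X)).exists_antitone_basis
  -- Starting with `univ`, whose polar is `{0}`, lets the induction begin at the empty set, because
  -- `0 ∉ C`.
  let V : ℕ → Set X := fun n => Nat.casesOn n univ u
  have hVnhds : ∀ n, V n ∈ 𝓝 (0 : X) := by
    rintro (_ | n)
    exacts [univ_mem, hu.mem n]
  have hVanti : Antitone V := by
    refine antitone_nat_of_succ_le ?_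
    rintro (_ | n)
    exacts [subset_univ _, hu.antitone n.le_succ]
  let P : ℕ → Finset X → Prop := fun n A =>
    ∀ y ∈ C, y ∈ WeakDual.polar 𝕜 (V n) → ∃ x ∈ A, 1 < ‖y x‖
  have hstart : P 0 ∅ := by
    intro y hyC hy
    exfalso
    have hy0 : y = 0 := by
      refine DFunLike.ext _ _ fun x => ?_
      by_contra hx
      have h1 : ‖y ((2 * (y x)⁻¹) • x)‖ ≤ 1 := hy _ (mem_univ _)
      have hx' : y x ≠ 0 := hx
      rw [map_smul, smul_eq_mul, mul_assoc, inv_mul_cancel₀ hx', mul_one, RCLike.norm_ofNat] at h1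
      norm_num at h1
    exact h0 (hy0 ▸ hyC)
  have hstep : ∀ n A, ∃ B : Finset X, P n A → (B : Set X) ⊆ V n ∧ P (n + 1) (A ∪ B) := by
    intro n A
    by_cases hA : P n A
    · obtain ⟨B, hB⟩ :=
        exists_finset_forall_exists_one_lt_norm (hVnhds (n + 1)) (hC _ (hVnhds (n + 1))) A hA
      exact ⟨B, fun _ => hB⟩
    · exact ⟨∅, fun h => absurd h hA⟩
  choose f hf using hstep
  let S : ℕ → Finset X := fun n => Nat.rec ∅ (fun n A => A ∪ f n A) n
  have hSP : ∀ n, P n (S n) := by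
    intro n
    induction n with
    | zero => exact hstart
    | succ n ih => exact (hf n (S n) ih).2
  have hSmono : Monotone S := monotone_nat_of_le_succ fun n => Finset.subset_union_left
  -- All points added after stage `n` lie in `V n`, so the union of the finite sets is precompact.
  have hSsub : ∀ n k x, x ∈ S (n + k) → x ∈ S n ∨ x ∈ V n := by
    intro n k
    induction k with
    | zero => exact fun x hx => Or.inl hx
    | succ k ih =>
      intro x hx
      rcases Finset.mem_union.1 hx with hx | hx
      · exact ih x hx
      · exact Or.inr (hVanti (Nat.le_add_right n k) ((hf _ _ (hSP (n + k))).1 hx))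
  have hT : ∀ W ∈ 𝓝 (0 : X), ∃ A : Set X, A.Finite ∧ {x | ∃ n, x ∈ S n} ⊆ A + W := by
    intro W hW
    obtain ⟨n, hn⟩ := hu.mem_iff.1 hW
    refine ⟨insert 0 {x | x ∈ S (n + 1)}, (Finset.finite_toSet _).insert 0, ?_⟩
    rintro x ⟨m, hx⟩
    rcases hSsub (n + 1) m x (hSmono (Nat.le_add_left m (n + 1)) hx) with h | h
    · exact ⟨x, mem_insert_of_mem _ h, 0, mem_of_mem_nhds hW, add_zero x⟩
    · exact ⟨0, mem_insert _ _, x, hn h, zero_add x⟩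
  obtain ⟨K, hK, hKc, hSK⟩ := exists_isCompact_absConvex_superset (𝕜 := 𝕜) hX hT
  refine ⟨K, hK, hKc, fun y hy => ?_⟩
  have hny : {x : X | ‖y x‖ ≤ 1} ∈ 𝓝 (0 : X) := by
    have h : Tendsto (fun x => ‖y x‖) (𝓝 0) (𝓝 0) := by
      have := (map_continuous y).norm.tendsto 0
      rwa [map_zero, norm_zero] at this
    filter_upwards [h.eventually_lt_const one_pos] with x hx using hx.le
  obtain ⟨n, hn⟩ := hu.mem_iff.1 hny
  obtain ⟨x, hx, hyx⟩ := hSP (n + 1) y hy fun x hx => hn hx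
  exact ⟨x, hSK ⟨n + 1, hx⟩, hyx⟩

/-- A form of the **Krein–Šmulian theorem** for Fréchet spaces. -/
theorem eq_top_of_forall_isClosed_inter_polar [PolynormableSpace 𝕜 X] [FirstCountableTopology X]
    (hX : @CompleteSpace X (IsTopologicalAddGroup.rightUniformSpace X))
    {H : Submodule 𝕜 (WeakDual 𝕜 X)}
    (hH : ∀ V ∈ 𝓝 (0 : X), IsClosed ((H : Set (WeakDual 𝕜 X)) ∩ WeakDual.polar 𝕜 V))
    (hsep : ∀ x : X, (∀ y ∈ H, y x = 0) → x = 0) : H = ⊤ := by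
  by_contra hne
  obtain ⟨y, -, hy⟩ := SetLike.exists_of_lt (lt_top_iff_ne_top.2 hne)
  -- Banach–Dieudonné is applied to the coset `y + H`, which avoids `0`.
  let C : Set (WeakDual 𝕜 X) := {z | z - y ∈ H}
  have hC : ∀ V ∈ 𝓝 (0 : X), IsClosed (C ∩ WeakDual.polar 𝕜 V) := by
    intro V hV
    have hy1 : {x : X | ‖y x‖ ≤ 1} ∈ 𝓝 (0 : X) := by
      have h : Tendsto (fun x => ‖y x‖) (𝓝 0) (𝓝 0) := by
        have := (map_continuous y).norm.tendsto 0
        rwa [map_zero, norm_zero] at this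
      filter_upwards [h.eventually_lt_const one_pos] with x hx using hx.le
    -- The factor `1/2` ensures `z - y ∈ W°` for `z ∈ V°`, as `z` and `y` are both bounded by `1` on
    -- `V ∩ {‖y‖ ≤ 1}`.
    let W : Set X := (2⁻¹ : 𝕜) • (V ∩ {x : X | ‖y x‖ ≤ 1})
    have hW : W ∈ 𝓝 (0 : X) := (set_smul_mem_nhds_zero_iff (by simp)).2 (inter_mem hV hy1)
    have heq : C ∩ WeakDual.polar 𝕜 V =
        (fun z => z - y) ⁻¹' ((H : Set (WeakDual 𝕜 X)) ∩ WeakDual.polar 𝕜 W) ∩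
          WeakDual.polar 𝕜 V := by
      ext z
      refine ⟨fun hz => ⟨⟨hz.1, ?_⟩, hz.2⟩, fun hz => ⟨hz.1.1, hz.2⟩⟩
      rintro _ ⟨v, hv, rfl⟩
      have h1 : ‖z v‖ ≤ 1 := hz.2 v hv.1
      have h2 : ‖y v‖ ≤ 1 := hv.2
      change ‖(z - y) ((2⁻¹ : 𝕜) • v)‖ ≤ 1
      rw [map_smul, norm_smul, norm_inv, RCLike.norm_ofNat]
      have h3 : ‖(z - y) v‖ ≤ ‖z v‖ + ‖y v‖ := norm_sub_le _ _
      linarith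
    rw [heq]
    exact ((hH W hW).preimage (continuous_id.sub continuous_const)).inter
      (WeakDual.isClosed_polar 𝕜 V)
  obtain ⟨K, hK, hKc, hKC⟩ := exists_isCompact_absConvex_forall_exists_one_lt_norm hX hC
    (fun h : (0 : WeakDual 𝕜 X) - y ∈ H => hy (by simpa using h))
  obtain ⟨x, -, hyx, hHx⟩ := exists_mem_forall_eq_zero_of_one_lt_norm H y hK hKc
    (fun h hh => hKC (y + h) (by simpa [C] using hh))
  rw [hsep x hHx, map_zero] at hyx
  exact zero_ne_one hyx

end BanachDieudonne

/-! ### Gauge convergence in locally complete spaces. -/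

section LocallyComplete

variable {𝕜 E : Type*} [RCLike 𝕜] [AddCommGroup E] [Module 𝕜 E]

theorem smul_sub_smul_mem_smul_of_absConvex {D : Set E} (hD : AbsConvex 𝕜 D) {x y : E}
    (hx : x ∈ D) (hy : y ∈ D) (m n : ℕ) :
    (m : 𝕜) • x - (n : 𝕜) • y ∈ ((m + n : ℕ) : 𝕜) • D := by
  rcases Nat.eq_zero_or_pos (m + n) with h | h
  · obtain ⟨rfl, rfl⟩ := Nat.add_eq_zero_iff.1 h
    exact ⟨x, hx, by simp⟩
  have hR : (0 : ℝ) < ((m + n : ℕ) : ℝ) := by exact_mod_cast h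
  have h0 : ((m + n : ℕ) : 𝕜) ≠ 0 := by exact_mod_cast h.ne'
  have hny : -y ∈ D := hD.1.neg_mem_iff.2 hy
  refine ⟨((m / (m + n : ℕ) : ℝ) : 𝕜) • x + ((n / (m + n : ℕ) : ℝ) : 𝕜) • -y,
    hD.2 hx hny (RCLike.ofReal_nonneg.2 (by positivity)) (RCLike.ofReal_nonneg.2 (by positivity))
      ?_, ?_⟩
  · rw [← RCLike.ofReal_add, ← add_div, ← Nat.cast_add, div_self hR.ne', RCLike.ofReal_one]
  · change ((m + n : ℕ) : 𝕜) • _ = _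
    rw [smul_add, smul_smul, smul_smul, smul_neg, ← sub_eq_add_neg, RCLike.ofReal_div,
      RCLike.ofReal_div, RCLike.ofReal_natCast, RCLike.ofReal_natCast, RCLike.ofReal_natCast,
      mul_div_cancel₀ _ h0, mul_div_cancel₀ _ h0]

theorem diskGauge_le_of_mem_smul {D : Set E} {x : E} {r : ℝ} (hr : 0 < r)
    (hx : x ∈ (r : 𝕜) • D) : diskGauge 𝕜 D x ≤ r :=
  csInf_le ⟨0, fun _ hs => hs.1.le⟩ ⟨hr, hx⟩

theorem exists_lt_mem_smul_of_diskGauge_lt {D : Set E} (hD : Balanced 𝕜 D) {x : E}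
    (hx : x ∈ diskSpace 𝕜 D) {ε : ℝ} (h : diskGauge 𝕜 D x < ε) :
    ∃ r : ℝ, 0 < r ∧ r < ε ∧ x ∈ (r : 𝕜) • D := by
  have hne : {r : ℝ | 0 < r ∧ x ∈ (r : 𝕜) • D}.Nonempty := by
    obtain ⟨n, hn⟩ := mem_iUnion.1 hx
    -- The index `0` contributes only the origin, for which the admissible radius `1` is used.
    rcases Nat.eq_zero_or_pos n with rfl | hpos
    · obtain ⟨d, hd, rfl⟩ := hn
      refine ⟨1, one_pos, 0, hD.zero_mem ⟨d, hd⟩, by simp⟩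
    · exact ⟨n, by exact_mod_cast hpos, by simpa using hn⟩
  obtain ⟨r, hr, hlt⟩ := exists_lt_of_csInf_lt hne h
  exact ⟨r, hr.1, hlt, hr.2⟩

variable [TopologicalSpace E] [IsTopologicalAddGroup E]

/-- The sequence has a gauge limit in `E_D`, and boundedness of `D` makes gauge convergence imply
convergence in `E`. -/
theorem IsLocallyComplete.exists_tendsto (hE : IsLocallyComplete 𝕜 E) {D : Set E}
    (hDcl : IsClosed D) (hDb : Bornology.IsVonNBounded 𝕜 D) (hD : AbsConvex 𝕜 D) {x : ℕ → E}
    (hxD : ∀ n, x n ∈ D)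
    (hx : ∀ ε : ℝ, 0 < ε → ∃ N, ∀ m ≥ N, ∀ n ≥ N, x m - x n ∈ (ε : 𝕜) • D) :
    ∃ a, Tendsto x atTop (𝓝 a) := by
  have hmem : ∀ n, x n ∈ diskSpace 𝕜 D := fun n =>
    mem_iUnion.2 ⟨1, x n, hxD n, by simp⟩
  obtain ⟨a, ha, hlim⟩ := hE D hDcl hDb hD x hmem (by
    intro ε hε
    obtain ⟨N, hN⟩ := hx (ε / 2) (half_pos hε)
    exact ⟨N, fun m hm n hn =>
      (diskGauge_le_of_mem_smul (half_pos hε) (hN m hm n hn)).trans_lt (half_lt_self hε)⟩)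
  obtain ⟨k, d, hd, hda⟩ := mem_iUnion.1 ha
  -- Outside `E_D` the infimum defining the gauge is over the empty set, so a small gauge says
  -- nothing there.
  have hsub : ∀ n, x n - a ∈ diskSpace 𝕜 D := by
    intro n
    have h := smul_sub_smul_mem_smul_of_absConvex hD (hxD n) hd 1 k
    rw [Nat.cast_one, one_smul] at h
    exact mem_iUnion.2 ⟨1 + k, hda ▸ h⟩
  refine ⟨a, ?_⟩
  rw [← tendsto_sub_nhds_zero_iff]
  intro V hV
  change ∀ᶠ n in atTop, x n - a ∈ V
  obtain ⟨ε, hε, hεV⟩ : ∃ ε : ℝ, 0 < ε ∧ ∀ r : ℝ, 0 < r → r < ε → (r : 𝕜) • D ⊆ V := by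
    have h := (hDb hV).eventually_nhds_zero (mem_of_mem_nhds hV)
    obtain ⟨ε, hε, h⟩ := Metric.eventually_nhds_iff.1 h
    refine ⟨ε, hε, fun r hr hrε => ?_⟩
    rintro _ ⟨d, hd, rfl⟩
    exact h (by simpa [abs_of_pos hr] using hrε) hd
  filter_upwards [hlim.eventually_lt_const hε] with n hn
  obtain ⟨r, hr, hrε, hmem⟩ := exists_lt_mem_smul_of_diskGauge_lt hD.1 (hsub n) hn
  exact hεV r hr hrε hmem

end LocallyComplete

/-! ### Boundedness for `σ(E, G)` and polars in Schwartz spaces. -/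

section Weak

variable {𝕜 E : Type*} [RCLike 𝕜] [AddCommGroup E] [Module 𝕜 E] [TopologicalSpace E]

theorem isVonNBounded_sigmaTopology (G : Submodule 𝕜 (StrongDual 𝕜 E)) {B : Set E}
    (hB : ∀ g ∈ G, ∃ r : ℝ, ∀ e ∈ B, ‖g e‖ ≤ r) :
    @Bornology.IsVonNBounded 𝕜 E _ _ _ (sigmaTopology 𝕜 G) B := by
  have h := withSeminorms_iInf (𝕜 := 𝕜) (E := E)
    (t := fun g : G => TopologicalSpace.induced (fun x : E => (g : StrongDual 𝕜 E) x) inferInstance) fun g : G =>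
    LinearMap.withSeminorms_induced (norm_withSeminorms 𝕜 𝕜) (g : StrongDual 𝕜 E).toLinearMap
  refine (@WithSeminorms.isVonNBounded_iff_seminorm_bounded _ _ _ _ _ _ _ (_) _ h).2 ?_
  rintro ⟨g, i⟩
  obtain ⟨r, hr⟩ := hB g g.2
  refine ⟨max r 0 + 1, by positivity, fun e he => ?_⟩
  exact ((hr e he).trans (le_max_left _ _)).trans_lt (lt_add_one _)

/-- If `G` vanishes at `e`, the line `𝕜 e` is `σ(E, G)`-bounded, hence bounded, which forces `e = 0`
by separation. -/
theorem DeterminesBoundedness.eq_zero [T1Space E] [IsTopologicalAddGroup E] [ContinuousSMul 𝕜 E]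
    {G : Submodule 𝕜 (StrongDual 𝕜 E)}
    (hG : DeterminesBoundedness 𝕜 G) {e : E} (he : ∀ g ∈ G, g e = 0) : e = 0 := by
  have hb : Bornology.IsVonNBounded 𝕜 (range fun c : 𝕜 => c • e) := by
    refine hG _ (isVonNBounded_sigmaTopology G fun g hg => ⟨0, ?_⟩)
    rintro _ ⟨c, rfl⟩
    simp [he g hg]
  by_contra hne
  have hV : {e}ᶜ ∈ 𝓝 (0 : E) := isOpen_compl_singleton.mem_nhds (Ne.symm hne)
  obtain ⟨c, hc, hc0⟩ := (((hb hV).eventually_nhds_zero (Ne.symm hne)).filter_mono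
    nhdsWithin_le_nhds |>.and (self_mem_nhdsWithin (s := {(0 : 𝕜)}ᶜ))).exists
  exact hc ⟨c⁻¹, rfl⟩ (by simp [smul_smul, mul_inv_cancel₀ hc0])

/-- On the polar of a zero neighbourhood of a Schwartz space, the weak-* topology is finer than the
topology of uniform convergence on a suitable zero neighbourhood. -/
theorem IsSchwartzLCS.exists_mem_nhds_eventually_norm_sub_le {X : Type*} [AddCommGroup X]
    [Module 𝕜 X] [TopologicalSpace X] (hX : IsSchwartzLCS 𝕜 X) {V : Set X} (hV : V ∈ 𝓝 (0 : X)) :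
    ∃ W ∈ 𝓝 (0 : X), W ⊆ V ∧ ∀ y ∈ WeakDual.polar 𝕜 V, ∀ ε : ℝ, 0 < ε →
      ∀ᶠ z in 𝓝[WeakDual.polar 𝕜 V] y, ∀ x ∈ W, ‖z x - y x‖ ≤ ε := by
  obtain ⟨W, hW, hWV⟩ := hX V hV
  -- Intersecting with `V` gives `V° ⊆ (W ∩ V)°`, which is needed later to keep representatives in
  -- one disk.
  refine ⟨W ∩ V, inter_mem hW hV, inter_subset_right, fun y hy ε hε => ?_⟩
  -- One third covers the error on `A`; two thirds cover `‖z v - y v‖ ≤ 2` on `V`.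
  obtain ⟨A, hA, hWA⟩ := hWV (ε / 3) (by positivity)
  have hev : ∀ᶠ z in 𝓝[WeakDual.polar 𝕜 V] y, ∀ a ∈ A, ‖z a - y a‖ < ε / 3 := by
    rw [eventually_all_finite hA]
    intro a _
    have h : Tendsto (fun z : WeakDual 𝕜 X => ‖z a - y a‖) (𝓝 y) (𝓝 0) := by
      have := ((WeakDual.eval_continuous a).sub continuous_const).norm.tendsto (f := fun
        z : WeakDual 𝕜 X => ‖z a - y a‖) y
      simpa using this
    exact (h.eventually_lt_const (by positivity)).filter_mono nhdsWithin_le_nhds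
  filter_upwards [hev, self_mem_nhdsWithin] with z hz hzV x hx
  obtain ⟨a, ha, _, ⟨v, hv, rfl⟩, rfl⟩ := hWA hx.1
  have h1 : ‖z v‖ ≤ 1 := hzV v hv
  have h2 : ‖y v‖ ≤ 1 := hy v hv
  have h3 := (hz a ha).le
  have h4 : z (a + ((ε / 3 : ℝ) : 𝕜) • v) - y (a + ((ε / 3 : ℝ) : 𝕜) • v) =
      (z a - y a) + ((ε / 3 : ℝ) : 𝕜) * (z v - y v) := by
    rw [map_add, map_add, map_smul, map_smul, smul_eq_mul, smul_eq_mul]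
    ring
  have h5 : ‖((ε / 3 : ℝ) : 𝕜)‖ = ε / 3 := RCLike.norm_of_nonneg (by positivity)
  calc _ ≤ ‖z a - y a‖ + ‖((ε / 3 : ℝ) : 𝕜) * (z v - y v)‖ := h4 ▸ norm_add_le _ _
    _ ≤ ε / 3 + ε / 3 * (1 + 1) := by
      rw [norm_mul, h5]
      gcongr
      exact (norm_sub_le _ _).trans (add_le_add h1 h2)
    _ = ε := by ring

end Weak

/-! ### Functionals represented in `E`. -/

section Extension

variable {𝕜 X E : Type*} [RCLike 𝕜] [AddCommGroup X] [Module 𝕜 X] [TopologicalSpace X]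
  [AddCommGroup E] [Module 𝕜 E] [TopologicalSpace E]

/-- `e` represents `y` with respect to the family `φ` if `g e = y (φ g)` for all `g ∈ G`. -/
def Represents (G : Submodule 𝕜 (StrongDual 𝕜 E)) (φ : StrongDual 𝕜 E → X) (y : WeakDual 𝕜 X)
    (e : E) : Prop :=
  ∀ g ∈ G, g e = y (φ g)

namespace Represents

variable {G : Submodule 𝕜 (StrongDual 𝕜 E)} {φ : StrongDual 𝕜 E → X} {y z : WeakDual 𝕜 X} {e d : E}

theorem zero : Represents G φ 0 0 := fun g _ => map_zero g

theorem add (hy : Represents G φ y e) (hz : Represents G φ z d) :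
    Represents G φ (y + z) (e + d) := fun g hg => by
  rw [map_add, hy g hg, hz g hg]
  rfl

theorem smul (c : 𝕜) (hy : Represents G φ y e) : Represents G φ (c • y) (c • e) := fun g hg => by
  rw [map_smul, hy g hg]
  rfl

theorem unique [T1Space E] [IsTopologicalAddGroup E] [ContinuousSMul 𝕜 E]
    (hG : DeterminesBoundedness 𝕜 G) (he : Represents G φ y e) (hd : Represents G φ y d) : e = d :=
  sub_eq_zero.1 (hG.eq_zero fun g hg => by rw [map_sub, he g hg, hd g hg, sub_self])

end Represents

/-- The subspace of functionals which are represented by an element of `E`. -/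
def representable (G : Submodule 𝕜 (StrongDual 𝕜 E)) (φ : StrongDual 𝕜 E → X) :
    Submodule 𝕜 (WeakDual 𝕜 X) where
  carrier := {y | ∃ e, Represents G φ y e}
  add_mem' := fun ⟨_, he⟩ ⟨_, hd⟩ => ⟨_, he.add hd⟩
  zero_mem' := ⟨0, Represents.zero⟩
  smul_mem' := fun c _ ⟨_, he⟩ => ⟨_, he.smul c⟩

/-- The elements of `E` representing functionals in the polar of `W`. -/
def representingDisk (G : Submodule 𝕜 (StrongDual 𝕜 E)) (φ : StrongDual 𝕜 E → X) (W : Set X) :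
    Set E :=
  {e | ∃ y ∈ WeakDual.polar 𝕜 W, Represents G φ y e}

variable {G : Submodule 𝕜 (StrongDual 𝕜 E)} {φ : StrongDual 𝕜 E → X}

theorem absConvex_representingDisk (W : Set X) : AbsConvex 𝕜 (representingDisk G φ W) := by
  constructor
  · rintro c hc _ ⟨e, ⟨y, hy, he⟩, rfl⟩
    refine ⟨c • y, fun x hx => ?_, he.smul c⟩
    change ‖c * y x‖ ≤ 1
    rw [norm_mul]
    exact mul_le_one₀ hc (norm_nonneg _) (hy x hx)
  · rintro e ⟨y, hy, he⟩ d ⟨z, hz, hd⟩ a b ha hb hab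
    refine ⟨a • y + b • z, fun x hx => ?_, (he.smul a).add (hd.smul b)⟩
    change ‖a * y x + b * z x‖ ≤ 1
    have hy1 : ‖y x‖ ≤ 1 := hy x hx
    have hz1 : ‖z x‖ ≤ 1 := hz x hx
    have hab1 : ‖a‖ + ‖b‖ = 1 := by
      have h : ((‖a‖ + ‖b‖ : ℝ) : 𝕜) = ((1 : ℝ) : 𝕜) := by
        rw [RCLike.ofReal_add, RCLike.norm_of_nonneg' ha, RCLike.norm_of_nonneg' hb, hab,
          RCLike.ofReal_one]
      exact RCLike.ofReal_injective h
    calc ‖a * y x + b * z x‖ ≤ ‖a‖ * ‖y x‖ + ‖b‖ * ‖z x‖ := by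
          rw [← norm_mul, ← norm_mul]
          exact norm_add_le _ _
      _ ≤ ‖a‖ * 1 + ‖b‖ * 1 := by gcongr
      _ = 1 := by rw [mul_one, mul_one, hab1]

theorem sub_mem_smul_representingDisk {W : Set X} {y z : WeakDual 𝕜 X} {e d : E}
    (he : Represents G φ y e) (hd : Represents G φ z d) {ε : ℝ} (hε : 0 < ε)
    (h : ∀ x ∈ W, ‖y x - z x‖ ≤ ε) : e - d ∈ (ε : 𝕜) • representingDisk G φ W := by
  have hε' : (ε : 𝕜) ≠ 0 := RCLike.ofReal_ne_zero.2 hε.ne'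
  rw [mem_smul_set_iff_inv_smul_mem₀ hε', sub_eq_add_neg, ← neg_one_smul 𝕜 d]
  refine ⟨_, fun x hx => ?_, (he.add (hd.smul (-1))).smul _⟩
  change ‖(ε : 𝕜)⁻¹ * (y x + -1 * z x)‖ ≤ 1
  rw [neg_one_mul, ← sub_eq_add_neg, norm_mul, norm_inv, RCLike.norm_of_nonneg hε.le,
    inv_mul_le_one₀ hε]
  exact h x hx

variable [ContinuousSMul 𝕜 X]

/-- `W` absorbs each `φ g`, so every `g ∈ G` is bounded on the disk; `G` then upgrades this weak
boundedness. -/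
theorem isVonNBounded_representingDisk (hG : DeterminesBoundedness 𝕜 G) {W : Set X}
    (hW : W ∈ 𝓝 (0 : X)) : Bornology.IsVonNBounded 𝕜 (representingDisk G φ W) := by
  refine hG _ (isVonNBounded_sigmaTopology G fun g hg => ?_)
  obtain ⟨c, hc, hcW⟩ := exists_smul_mem_of_mem_nhds_zero 𝕜 hW (φ g)
  refine ⟨‖c‖⁻¹, ?_⟩
  rintro e ⟨y, hy, he⟩
  have h : ‖y (c • φ g)‖ ≤ 1 := hy _ hcW
  rw [map_smul, norm_smul] at h
  rwa [he g hg, ← one_div, le_div_iff₀' (norm_pos_iff.2 hc)]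

variable [IsTopologicalAddGroup E]

/-- This is weak-* continuity of `A` on `V°`: for `z` near `y` in `V°`, the difference `A z - A y`
lies in a small multiple of a bounded disk. -/
theorem isClosed_setOf_notMem_inter_polar (hG : DeterminesBoundedness 𝕜 G)
    (hX : IsSchwartzLCS 𝕜 X) {A : WeakDual 𝕜 X → E} (hA : ∀ y, Represents G φ y (A y))
    {N : Set E} (hN : IsOpen N) {V : Set X} (hV : V ∈ 𝓝 (0 : X)) :
    IsClosed ({y | A y ∉ N} ∩ WeakDual.polar 𝕜 V) := by
  refine isClosed_of_closure_subset fun y hy => ?_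
  have hyV : y ∈ WeakDual.polar 𝕜 V :=
    (WeakDual.isClosed_polar 𝕜 V).closure_subset_iff.2 inter_subset_right hy
  refine ⟨fun hyN => ?_, hyV⟩
  obtain ⟨W, hW, -, hWy⟩ := hX.exists_mem_nhds_eventually_norm_sub_le hV
  have hM : {v | v + A y ∈ N} ∈ 𝓝 (0 : E) :=
    (hN.preimage (continuous_add_const (A y))).mem_nhds (by simpa using hyN)
  obtain ⟨ε, hε, hεM⟩ : ∃ ε : ℝ, 0 < ε ∧ (ε : 𝕜) • representingDisk G φ W ⊆ {v | v + A y ∈ N} := by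
    obtain ⟨δ, hδ, h⟩ := Metric.eventually_nhds_iff.1
      ((isVonNBounded_representingDisk (φ := φ) hG hW hM).eventually_nhds_zero (mem_of_mem_nhds hM))
    refine ⟨δ / 2, half_pos hδ, ?_⟩
    rintro _ ⟨d, hd, rfl⟩
    refine h ?_ hd
    rw [dist_zero_right, RCLike.norm_of_nonneg (half_pos hδ).le]
    exact half_lt_self hδ
  have := mem_closure_iff_nhdsWithin_neBot.1 hy
  obtain ⟨z, hz, hzN, -⟩ := (((hWy y hyV ε hε).filter_mono
    (nhdsWithin_mono y (inter_subset_right (s := {y | A y ∉ N})))).and self_mem_nhdsWithin).exists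
  refine hzN ?_
  have h : A z - A y + A y ∈ N := hεM (sub_mem_smul_representingDisk (hA z) (hA y) hε hz)
  rwa [sub_add_cancel] at h

variable [ContinuousSMul 𝕜 E] [T2Space E]

/-- A point of the closure is a limit, uniformly on `W`, of a sequence of represented functionals.
Their representatives are Cauchy for the gauge of a closed bounded disk, and their limit represents
the given point. -/
theorem isClosed_representable_inter_polar (hE : IsLocallyComplete 𝕜 E)
    (hG : DeterminesBoundedness 𝕜 G) (hX : IsSchwartzLCS 𝕜 X) {V : Set X} (hV : V ∈ 𝓝 (0 : X)) :
    IsClosed ((representable G φ : Set (WeakDual 𝕜 X)) ∩ WeakDual.polar 𝕜 V) := by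
  refine isClosed_of_closure_subset fun y hy => ?_
  have hyV : y ∈ WeakDual.polar 𝕜 V :=
    (WeakDual.isClosed_polar 𝕜 V).closure_subset_iff.2 inter_subset_right hy
  refine ⟨?_, hyV⟩
  obtain ⟨W, hW, hWV, hWy⟩ := hX.exists_mem_nhds_eventually_norm_sub_le hV
  have hex : ∀ k : ℕ, ∃ z ∈ WeakDual.polar 𝕜 V, ∃ e, Represents G φ z e ∧
      ∀ x ∈ W, ‖z x - y x‖ ≤ 1 / ((k : ℝ) + 1) := by
    intro k
    have := mem_closure_iff_nhdsWithin_neBot.1 hy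
    obtain ⟨z, hz, hzm⟩ := (((hWy y hyV _ Nat.one_div_pos_of_nat).filter_mono
      (nhdsWithin_mono y
        (inter_subset_right (s := (representable G φ : Set (WeakDual 𝕜 X)))))).and self_mem_nhdsWithin).exists
    obtain ⟨⟨e, he⟩, hzV⟩ := hzm
    exact ⟨z, hzV, e, he, hz⟩
  choose z hzV e he hz using hex
  obtain ⟨a, ha⟩ := hE.exists_tendsto (D := closure (representingDisk G φ W)) isClosed_closure
    (isVonNBounded_representingDisk hG hW).closure (absConvex_representingDisk W).closure
    (x := e) (fun k => subset_closure ⟨z k, fun x hx => hzV k x (hWV hx), he k⟩) (by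
      intro ε hε
      obtain ⟨N, hN⟩ := exists_nat_one_div_lt (half_pos hε)
      refine ⟨N, fun m hm n hn => smul_set_mono subset_closure
        (sub_mem_smul_representingDisk (he m) (he n) hε fun x hx => ?_)⟩
      have hm' := (hz m x hx).trans (Nat.one_div_le_one_div hm)
      have hn' := (hz n x hx).trans (Nat.one_div_le_one_div hn)
      calc ‖z m x - z n x‖ ≤ ‖z m x - y x‖ + ‖z n x - y x‖ := by
            rw [norm_sub_rev (z n x)]
            exact norm_sub_le_norm_sub_add_norm_sub _ _ _
        _ ≤ ε := by linarith)
  refine ⟨a, fun g hg => ?_⟩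
  refine tendsto_nhds_unique ((g.continuous.tendsto a).comp ha) ?_
  -- Absorbing `φ g` into `W` converts uniform convergence on `W` into convergence at `φ g`.
  obtain ⟨c, hc, hcW⟩ := exists_smul_mem_of_mem_nhds_zero 𝕜 hW (φ g)
  rw [tendsto_iff_norm_sub_tendsto_zero]
  refine squeeze_zero (g := fun k : ℕ => ‖c‖⁻¹ * (1 / ((k : ℝ) + 1))) (fun _ => norm_nonneg _)
    (fun k => ?_) ?_
  · have h := hz k _ hcW
    rw [map_smul, map_smul, ← smul_sub, norm_smul] at h
    rw [Function.comp_apply, he k g hg, inv_mul_eq_div, le_div_iff₀' (norm_pos_iff.2 hc)]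
    exact h
  · simpa using tendsto_one_div_add_atTop_nhds_zero_nat.const_mul ‖c‖⁻¹

variable [IsTopologicalAddGroup X] [PolynormableSpace 𝕜 X]

/-- If the representable functionals on a Fréchet–Schwartz space `X` separate its points, then every
functional is representable, by means of a continuous linear map `X'_κ → E`. -/
theorem exists_epsProduct_represents (hE : IsLocallyComplete 𝕜 E)
    (hG : DeterminesBoundedness 𝕜 G) (hX : IsFrechetSchwartz 𝕜 X)
    (hsep : ∀ x : X, (∀ y ∈ representable G φ, y x = 0) → x = 0) :
    ∃ u : EpsProduct 𝕜 X E, ∀ y : StrongDual 𝕜 X,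
      Represents G φ (StrongDual.toWeakDual y) (u (toDualKappa 𝕜 y)) := by
  have := hX.metrizable
  have htop : representable G φ = ⊤ := eq_top_of_forall_isClosed_inter_polar hX.complete
    (fun V hV => isClosed_representable_inter_polar hE hG hX.schwartz hV) hsep
  have hex : ∀ y : WeakDual 𝕜 X, ∃ e, Represents G φ y e := fun y =>
    (htop ▸ Submodule.mem_top : y ∈ representable G φ)
  choose A hA using hex
  -- The chosen representatives depend linearly on `y` because they are unique.
  let L : DualKappa 𝕜 X →ₗ[𝕜] E :=
    { toFun := fun y => A ((UniformConvergenceCLM.ofFun (RingHom.id 𝕜) 𝕜 _).symm y)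
      map_add' := fun y z => (hA _).unique hG ((hA _).add (hA _))
      map_smul' := fun c y => (hA _).unique hG ((hA _).smul c) }
  have hL : Continuous L := by
    refine continuous_of_continuousAt_zero L ?_
    rw [ContinuousAt, map_zero]
    refine (nhds_basis_opens (0 : E)).tendsto_right_iff.2 fun N ⟨h0N, hN⟩ => ?_
    -- Banach–Dieudonné for the complement of `A⁻¹(N)` yields a compact disk `K` with `K° ⊆ A⁻¹(N)`.
    obtain ⟨K, hK, hKc, hKN⟩ := exists_isCompact_absConvex_forall_exists_one_lt_norm hX.complete
      (C := {y | A y ∉ N})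
      (fun V hV => isClosed_setOf_notMem_inter_polar hG hX.schwartz hA hN hV)
      (fun h => h ((hA 0).unique hG Represents.zero ▸ h0N))
    have hev : ∀ᶠ y : DualKappa 𝕜 X in 𝓝 0, MapsTo y K (Metric.closedBall (0 : 𝕜) 1) :=
      UniformConvergenceCLM.eventually_nhds_zero_mapsTo (RingHom.id 𝕜)
        (𝔖 := {K : Set X | IsCompact K ∧ AbsConvex 𝕜 K}) ⟨hK, hKc⟩
        (Metric.closedBall_mem_nhds 0 one_pos)
    filter_upwards [hev] with y hy
    by_contra hyN
    obtain ⟨x, hx, hlt⟩ := hKN _ hyN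
    exact hlt.not_ge (mem_closedBall_zero_iff.1 (hy hx))
  exact ⟨UniformConvergenceCLM.ofFun (RingHom.id 𝕜) E _ ⟨L, hL⟩, fun y => hA _⟩

end Extension

/-! ### Surjectivity of the restriction map. -/

theorem mainTheorem5 {𝕜 Ω M E : Type*} [RCLike 𝕜] {ω : M → Type*}
    [AddCommGroup E] [Module 𝕜 E] [TopologicalSpace E] [IsTopologicalAddGroup E]
    [ContinuousSMul 𝕜 E] [PolynormableSpace 𝕜 E] [T2Space E]
    (hE : IsLocallyComplete 𝕜 E)
    (G : Submodule 𝕜 (StrongDual 𝕜 E)) (hG : DeterminesBoundedness 𝕜 G)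
    (F : FunctionSpace 𝕜 Ω 𝕜) (FE : FunctionSpace 𝕜 Ω E)
    (hδ : F.HasContinuousEvals) (hc : EpsIntoCompatible F FE hδ)
    (TE : OperatorFamily FE ω) (TK : OperatorFamily F ω)
    (hstrong : IsStrong TE TK) (hcons : IsConsistent hδ TE TK)
    (hF : IsFrechetSchwartz 𝕜 F)
    (U : Set (Σ m, ω m)) (hU : IsSetOfUniqueness TK U) :
    Function.Surjective (restrictionMap hc hstrong G U) := by
  rintro ⟨f, hf⟩
  have hex : ∀ g : StrongDual 𝕜 E, ∃ x : F, g ∈ G → ∀ p : U, TK.op p.1.1 x p.1.2 = g (f p) := by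
    intro g
    by_cases hg : g ∈ G
    · obtain ⟨x, hx⟩ := hf g hg
      exact ⟨x, fun _ => hx⟩
    · exact ⟨0, fun h => absurd h hg⟩
  -- No linearity of `φ` is needed, since representation is tested one `g ∈ G` at a time; the values
  -- off `G` play no role.
  choose φ hφ using hex
  let T : U → StrongDual 𝕜 F := fun p =>
    ⟨(LinearMap.proj p.1.2).comp (TK.op p.1.1), hcons.continuousAt p.1.1 p.1.2⟩
  have hT : ∀ p : U, Represents G φ (StrongDual.toWeakDual (T p)) (f p) :=
    fun p g hg => (hφ g hg p).symm
  obtain ⟨u, hu⟩ := exists_epsProduct_represents (φ := φ) hE hG hF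
    (fun x hx => hU.eq_zero x fun p hp => hx (StrongDual.toWeakDual (T ⟨p, hp⟩)) ⟨_, hT ⟨p, hp⟩⟩)
  refine ⟨⟨epsMap hδ u, u, rfl⟩, Subtype.ext (funext fun p => ?_)⟩
  -- Both `u (T p)` and `f p` represent `T p`.
  exact (hcons.apply_epsMap u p.1.1 p.1.2).trans ((hu (T p)).unique hG (hT p))
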